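/- Let $P(z)=\sum_{j=0}^{n}a_jz^j$ be a complex polynomial of degree $n\ge 2$ all of whose zeros lie in $|z|\le k$, where $k\ge 1$ is real. Put $$\phi(k)=\begin{cases}\dfrac{k^{n}-1}{n}-\dfrac{k^{n-2}-1}{n-2}, & n>2,\\[2mm] \dfrac{(k-1)^2}{2}, & n=2,\end{cases}\qquad \psi(k)=\begin{cases}1-\dfrac1{k^{2}}, & n>2,\\[2mm] 1-\dfrac1k, & n=2.\end{cases}$$ Then $$\max_{|z|=1}|P'(z)|\ \ge\ \frac{1}{1+k^{n}}\left(n+\frac{k^{n}|a_n|-|a_0|}{k^{n}|a_n|+|a_0|}\right)\max_{|z|=1}|P(z)|+\frac{|a_{n-1}|}{k(1+k^{n})}\left(n+\frac{k^{n}|a_n|-|a_0|}{k^{n}|a_n|+|a_0|}\right)\phi(k)+|a_1|\psi(k).$$ This refines Govil's inequality $\max_{|z|=1}|P'(z)|\ge\frac{n}{1+k^n}\max_{|z|=1}|P(z)|$: the right-hand side above is at least $\frac{n}{1+k^{n}}\max_{|z|=1}|P(z)|$. For $k=1$ the right-hand side above equals $\frac12\left(n+\frac{|a_n|-|a_0|}{|a_n|+|a_0|}\right)\max_{|z|=1}|P(z)|$,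 so the inequality reduces to Dubinin's inequality. The result is best possible: equality holds for $P(z)=z^{n}+k^{n}$. -/

import Mathlib

/-- The maximum modulus of the complex polynomial `P` on the unit circle. -/
noncomputable def maxOnUnitCircle (P : Polynomial ℂ) : ℝ :=
  sSup ((fun z : ℂ => ‖P.eval z‖) '' Metric.sphere (0 : ℂ) 1)

/-- The supremum in `maxOnUnitCircle` is a maximum. -/
theorem maxOnUnitCircle_isGreatest (P : Polynomial ℂ) :
    IsGreatest ((fun z : ℂ => ‖P.eval z‖) '' Metric.sphere (0 : ℂ) 1) (maxOnUnitCircle P) := by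
  refine IsCompact.isGreatest_sSup ?_ ?_
  · exact (isCompact_sphere (0 : ℂ) 1).image (by fun_prop)
  · exact ⟨_, 1, by simp, rfl⟩

/-- The function `φ(k)` attached to the degree `n` (used for `n ≥ 2`). -/
noncomputable def govilPhi (n : ℕ) (k : ℝ) : ℝ :=
  if n = 2 then (k - 1) ^ 2 / 2
  else (k ^ n - 1) / (n : ℝ) - (k ^ (n - 2) - 1) / ((n : ℝ) - 2)

/-- The function `ψ(k)` attached to the degree `n` (used for `n ≥ 2`). -/
noncomputable def govilPsi (n : ℕ) (k : ℝ) : ℝ :=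
  if n = 2 then 1 - 1 / k else 1 - 1 / k ^ 2

/-- The factor `n + (kⁿ|aₙ| - |a₀|) / (kⁿ|aₙ| + |a₀|)`. -/
noncomputable def coeffFactor (n : ℕ) (k : ℝ) (P : Polynomial ℂ) : ℝ :=
  (n : ℝ) + (k ^ n * ‖P.coeff n‖ - ‖P.coeff 0‖) / (k ^ n * ‖P.coeff n‖ + ‖P.coeff 0‖)

/-- The lower bound for the maximum of `|P'|` on the unit circle. -/
noncomputable def derivLowerBound (n : ℕ) (k : ℝ) (P : Polynomial ℂ) : ℝ :=
  1 / (1 + k ^ n) * coeffFactor n k P * maxOnUnitCircle P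
    + ‖P.coeff (n - 1)‖ / (k * (1 + k ^ n)) * coeffFactor n k P * govilPhi n k
    + ‖P.coeff 1‖ * govilPsi n k

/-! The bound is a chain of three estimates through the circle `|z| = k`. Write `M` for a maximum on
the unit circle, `F` for `coeffFactor` and `T(z) = (z/k)^n P(k/z)`, whose zeros lie in `|z| ≥ 1`.
(1) `|T|` on `|z| = k` reproduces `|P|` on the unit circle, so a refined Ankeny–Rivlin bound for `T`
gives a point `kv`, `|v| = 1`, with `M(P) + |a_{n-1}| φ(k)/k ≤ (k^n+1)/(2k^n) |P(kv)|`
(`exists_maxOnUnitCircle_add_le`). (2) Dubinin's inequality on that circle: `(F/2) |P(kv)| ≤ k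
|P'(kv)|` (`coeffFactor_half_mul_norm_eval_le`). (3) Growth of `P'`: `|P'(kv)| + φ'(k) |a_1| ≤
k^(n-1) M(P')`, where `k φ'(k) = k^n ψ(k)`. The growth estimate behind (3) also yields (1): applied
to `T'` together with the Erdős–Lax inequality, it is integrated along a ray. -/

/-! ### Growth of polynomials outside the unit disk, via unitary operators. -/

-- By the functional calculus, `p(U)` has norm at most the supremum of `|p|` on the spectrum of `U`,
-- which lies on the unit circle.
open Polynomial in
theorem norm_inner_aeval_linearIsometryEquiv_le {H : Type*} [NormedAddCommGroup H]
    [InnerProductSpace ℂ H] [CompleteSpace H] (U : H ≃ₗᵢ[ℂ] H) (p : ℂ[X]) {M : ℝ}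
    (hM : ∀ z : ℂ, ‖z‖ = 1 → ‖p.eval z‖ ≤ M) (x y : H) :
    ‖inner ℂ x (aeval (U : H →L[ℂ] H) p y)‖ ≤ M * ‖x‖ * ‖y‖ := by
  have hM0 : 0 ≤ M := (norm_nonneg _).trans (hM 1 (by simp))
  have hU : ((U : H →L[ℂ] H)) ∈ unitary (H →L[ℂ] H) :=
    (Unitary.linearIsometryEquiv.symm U).2
  have hn : IsStarNormal (U : H →L[ℂ] H) := isStarNormal_of_mem_unitary hU
  have h : ‖aeval (U : H →L[ℂ] H) p‖ ≤ M := by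
    rw [← cfc_polynomial p (U : H →L[ℂ] H) hn]
    refine norm_cfc_le hM0 fun z hz => hM z ?_
    simpa using spectrum.subset_circle_of_unitary hU hz
  calc _ ≤ ‖x‖ * ‖aeval (U : H →L[ℂ] H) p y‖ := norm_inner_le_norm _ _
    _ ≤ ‖x‖ * (M * ‖y‖) := by
        gcongr
        exact ContinuousLinearMap.le_of_opNorm_le _ h y
    _ = _ := by ring

/-- These moments turn a matrix coefficient of `p(U)` into a value of `p` plus a free multiple of
its constant term. With `σ² = 1 - ρ²`, `U` sends `b_0` to `ρ b_0 + σ b_1`, shifts `b_1, …, b_l`, and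
closes up with `b_{l+1} ↦ c(σ b_0 - ρ b_1)`; only this last step brings in `c`. -/
theorem exists_linearIsometryEquiv_moments (l : ℕ) {ρ : ℝ} (h0 : 0 ≤ ρ) (h1 : ρ ≤ 1) {c : ℂ}
    (hc : ‖c‖ = 1) :
    ∃ (U : EuclideanSpace ℂ (Fin (l + 2)) ≃ₗᵢ[ℂ] EuclideanSpace ℂ (Fin (l + 2)))
      (e : EuclideanSpace ℂ (Fin (l + 2))), ‖e‖ = 1 ∧
      (∀ j ≤ l + 1, inner ℂ e (U^[j] e) = (ρ : ℂ) ^ j) ∧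
      inner ℂ e (U^[l + 2] e) = (ρ : ℂ) ^ (l + 2) + c * (1 - (ρ : ℂ) ^ 2) := by
  obtain ⟨σ, hσ⟩ : ∃ σ : ℝ, ρ ^ 2 + σ ^ 2 = 1 :=
    ⟨√(1 - ρ ^ 2), by rw [Real.sq_sqrt (by nlinarith)]; ring⟩
  have hσ' : (ρ : ℂ) ^ 2 + (σ : ℂ) ^ 2 = 1 := by exact_mod_cast hσ
  have hcc : (starRingEnd ℂ) c * c = 1 := by
    rw [Complex.conj_mul', hc]; simp
  obtain ⟨b⟩ : Nonempty (OrthonormalBasis (Fin (l + 2)) ℂ (EuclideanSpace ℂ (Fin (l + 2)))) :=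
    ⟨EuclideanSpace.basisFun _ ℂ⟩
  have hb : ∀ i j, inner ℂ (b i) (b j) = if i = j then (1 : ℂ) else 0 :=
    fun i j => orthonormal_iff_ite.1 b.orthonormal i j
  let w : Fin (l + 2) → EuclideanSpace ℂ (Fin (l + 2)) :=
    Fin.cons ((ρ : ℂ) • b 0 + (σ : ℂ) • b 1)
      (Fin.snoc (α := fun _ => EuclideanSpace ℂ (Fin (l + 2))) (fun i : Fin l => b i.succ.succ)
        (c • ((σ : ℂ) • b 0 - (ρ : ℂ) • b 1)))
  have w0 : w 0 = (ρ : ℂ) • b 0 + (σ : ℂ) • b 1 := rfl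
  have w1 : w (Fin.last l).succ = c • ((σ : ℂ) • b 0 - (ρ : ℂ) • b 1) := by
    simp [w]
  have w2 : ∀ i : Fin l, w i.castSucc.succ = b i.succ.succ := fun i => by simp [w]
  have hs0 : ∀ i : Fin l, i.succ.succ ≠ 0 := fun i => Fin.succ_ne_zero _
  have hs1 : ∀ i : Fin l, i.succ.succ ≠ 1 := fun i => by
    simp [Fin.ext_iff]
  have hw : Orthonormal ℂ w := by
    rw [orthonormal_iff_ite]
    intro i j
    induction i using Fin.cases with
    | zero =>
      induction j using Fin.cases with
      | zero =>
        simp only [w0, inner_add_left, inner_add_right, inner_smul_left, inner_smul_right, hb]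
        simp
        linear_combination hσ'
      | succ j =>
        rw [if_neg (Fin.succ_ne_zero _).symm]
        induction j using Fin.lastCases with
        | last =>
          simp only [w0, w1, inner_add_left, inner_sub_right, inner_smul_left, inner_smul_right, hb]
          simp
          exact Or.inr (by ring)
        | cast j =>
          simp only [w0, w2, inner_add_left, inner_smul_left, hb]
          simp [(hs0 j).symm, (hs1 j).symm]
    | succ i =>
      induction i using Fin.lastCases with
      | last =>
        induction j using Fin.cases with
        | zero =>
          simp only [w0, w1, inner_add_right, inner_sub_left, inner_smul_left, inner_smul_right,
            hb]
          simp
          ring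
        | succ j =>
          induction j using Fin.lastCases with
          | last =>
            simp only [w1, inner_sub_left, inner_sub_right, inner_smul_left, inner_smul_right, hb]
            simp
            linear_combination (ρ ^ 2 + σ ^ 2 : ℂ) * hcc + hσ'
          | cast j =>
            rw [if_neg (fun h => (Fin.castSucc_lt_last j).ne' (Fin.succ_injective _ h))]
            simp only [w1, w2, inner_sub_left, inner_smul_left, hb]
            simp [(hs0 j).symm, (hs1 j).symm]
      | cast i =>
        induction j using Fin.cases with
        | zero =>
          simp only [w0, w2, inner_add_right, inner_smul_right, hb]
          simp [hs0, hs1]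
        | succ j =>
          induction j using Fin.lastCases with
          | last =>
            rw [if_neg (fun h => (Fin.castSucc_lt_last i).ne (Fin.succ_injective _ h))]
            simp only [w1, w2, inner_sub_right, inner_smul_right, hb]
            simp [hs0, hs1]
          | cast j => simp [w2, hb]
  let b' : OrthonormalBasis (Fin (l + 2)) ℂ (EuclideanSpace ℂ (Fin (l + 2))) :=
    OrthonormalBasis.mk hw (hw.linearIndependent.span_eq_top_of_card_eq_finrank (by simp)).ge
  let U := b.equiv b' (Equiv.refl _)
  have hU : ∀ i, U (b i) = w i := fun i => by simp [U, b']
  have hrec : ∀ j (hj : j ≤ l),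
      U^[j + 1] (b 0) = (ρ : ℂ) • U^[j] (b 0) + (σ : ℂ) • b ⟨j + 1, by omega⟩ := by
    intro j
    induction j with
    | zero => intro _; simp only [zero_add, Function.iterate_one, Function.iterate_zero, id, hU, w0]; rfl
    | succ j ih =>
      intro hj
      rw [Function.iterate_succ_apply' _ (j + 1), ih (by omega), map_add, map_smul, map_smul, hU,
        ← Function.iterate_succ_apply' U, ← ih (by omega)]
      congr 2
      exact w2 ⟨j, by omega⟩
  have hmom : ∀ j ≤ l + 1, inner ℂ (b 0) (U^[j] (b 0)) = (ρ : ℂ) ^ j := by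
    intro j
    induction j with
    | zero => intro _; simp
    | succ j ih =>
      intro hj
      rw [hrec j (by omega), inner_add_right, inner_smul_right, inner_smul_right, ih (by omega),
        hb, if_neg (by simp [Fin.ext_iff])]
      ring
  refine ⟨U, b 0, by simp, hmom, ?_⟩
  have hlast : U (b ⟨l + 1, by omega⟩) = c • ((σ : ℂ) • b 0 - (ρ : ℂ) • b 1) := (hU _).trans w1
  rw [Function.iterate_succ_apply', hrec l le_rfl, map_add, map_smul, map_smul, hlast,
    ← Function.iterate_succ_apply' U, inner_add_right, inner_smul_right, inner_smul_right,
    inner_smul_right, inner_sub_right, inner_smul_right, inner_smul_right, hb, hb,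
    hmom _ le_rfl]
  simp
  linear_combination c * hσ'

open Polynomial in
theorem norm_eval_le_maxOnUnitCircle (P : ℂ[X]) {z : ℂ} (hz : ‖z‖ = 1) :
    ‖P.eval z‖ ≤ maxOnUnitCircle P :=
  (maxOnUnitCircle_isGreatest P).2 ⟨z, by simpa using hz, rfl⟩

open Polynomial in
theorem exists_norm_eval_eq_maxOnUnitCircle (P : ℂ[X]) :
    ∃ z : ℂ, ‖z‖ = 1 ∧ ‖P.eval z‖ = maxOnUnitCircle P := by
  obtain ⟨z, hz, h⟩ := (maxOnUnitCircle_isGreatest P).1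
  exact ⟨z, by simpa using hz, h⟩

theorem maxOnUnitCircle_nonneg (P : Polynomial ℂ) : 0 ≤ maxOnUnitCircle P :=
  (norm_nonneg _).trans (norm_eval_le_maxOnUnitCircle P (z := 1) (by simp))

theorem exists_norm_eq_one_norm_add_mul (a b : ℂ) : ∃ c : ℂ, ‖c‖ = 1 ∧ ‖a + c * b‖ = ‖a‖ + ‖b‖ := by
  obtain ⟨u, hu, hua⟩ : ∃ u : ℂ, ‖u‖ = 1 ∧ a = ‖a‖ * u :=
    ⟨_, Complex.norm_exp_ofReal_mul_I a.arg, (Complex.norm_mul_exp_arg_mul_I a).symm⟩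
  obtain ⟨v, hv, hvb⟩ : ∃ u : ℂ, ‖u‖ = 1 ∧ b = ‖b‖ * u :=
    ⟨_, Complex.norm_exp_ofReal_mul_I b.arg, (Complex.norm_mul_exp_arg_mul_I b).symm⟩
  have hv0 : v ≠ 0 := by rintro rfl; simp at hv
  refine ⟨u / v, by simp [hu, hv], ?_⟩
  have : a + u / v * b = ((‖a‖ + ‖b‖ : ℝ) : ℂ) * u := by
    conv_lhs => rw [hua, hvb]
    push_cast
    field_simp
  rw [this, norm_mul, hu, mul_one, Complex.norm_real, Real.norm_of_nonneg (by positivity)]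

open Polynomial in
/-- The Frappier–Rahman–Ruscheweyh growth inequality at a positive point. -/
theorem norm_eval_ofReal_add_le {p : ℂ[X]} {m : ℕ} (hm : 2 ≤ m) (hp : p.natDegree ≤ m) {M : ℝ}
    (hM : ∀ z : ℂ, ‖z‖ = 1 → ‖p.eval z‖ ≤ M) {r : ℝ} (hr : 1 ≤ r) :
    ‖p.eval (r : ℂ)‖ + (r ^ m - r ^ (m - 2)) * ‖p.coeff 0‖ ≤ r ^ m * M := by
  obtain ⟨l, rfl⟩ : ∃ l, m = l + 2 := ⟨m - 2, by omega⟩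
  have hr0 : 0 < r := by linarith
  have hrc : (r : ℂ) ≠ 0 := by exact_mod_cast hr0.ne'
  have hpos : 0 ≤ r ^ (l + 2) - r ^ l := by
    have := pow_le_pow_right₀ hr (show l ≤ l + 2 by omega); linarith
  obtain ⟨c, hc, hcc⟩ := exists_norm_eq_one_norm_add_mul (p.eval (r : ℂ))
    ((r ^ (l + 2) - r ^ l : ℝ) * p.coeff 0)
  -- The conjugate of `c` is used because the moments appear below with the two sides of the inner
  -- product exchanged.
  obtain ⟨U, e, he, hj, hl⟩ := exists_linearIsometryEquiv_moments l (ρ := r⁻¹) (by positivity)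
    (inv_le_one_of_one_le₀ hr) (c := starRingEnd ℂ c) (by simpa using hc)
  have hiso : ∀ (j i : ℕ) x y, inner ℂ (U^[j + i] x) (U^[j] y) = inner ℂ (U^[i] x) y := by
    intro j i x y
    induction j with
    | zero => simp
    | succ j ih =>
      rw [show j + 1 + i = (j + i) + 1 by ring, Function.iterate_succ_apply',
        Function.iterate_succ_apply', U.inner_map_map, ih]
  have hnorm : ∀ j, ‖U^[j] e‖ = 1 := by
    intro j
    induction j with
    | zero => simpa using he
    | succ j ih => rw [Function.iterate_succ_apply', U.norm_map, ih]
  have hpow : ∀ j, ((U : _ →L[ℂ] _) ^ j) e = U^[j] e := by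
    intro j
    rw [FunLike.coe_pow_eq_iterate]
    rfl
  have key := norm_inner_aeval_linearIsometryEquiv_le U p hM (U^[l + 2] e) e
  rw [hnorm, he, mul_one, mul_one] at key
  -- The coefficient of `z^i` is paired with the conjugate of moment `l + 2 - i`. With `ρ = 1/r` the
  -- geometric moments sum to `p(r)`, and only `i = 0` sees the extra term.
  have hsum : (r : ℂ) ^ (l + 2) * inner ℂ (U^[l + 2] e) (aeval (U : _ →L[ℂ] _) p e) =
      p.eval (r : ℂ) + c * ((r ^ (l + 2) - r ^ l : ℝ) * p.coeff 0) := by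
    rw [aeval_eq_sum_range' (Nat.lt_succ_of_le hp), eval_eq_sum_range' (Nat.lt_succ_of_le hp),
      sum_apply, inner_sum, Finset.mul_sum, Finset.sum_range_succ',
      Finset.sum_range_succ' (n := l + 2), add_assoc]
    congr 1
    · refine Finset.sum_congr rfl fun i hi => ?_
      have hi' := Finset.mem_range.1 hi
      have hin := hiso (i + 1) (l + 1 - i) e e
      have hpw := pow_add (r : ℂ) (i + 1) (l + 1 - i)
      rw [show i + 1 + (l + 1 - i) = l + 2 by omega] at hin hpw
      rw [smul_apply, hpow, inner_smul_right, hin, ← inner_conj_symm, hj _ (by omega), hpw]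
      simp only [map_pow, Complex.conj_ofReal]
      push_cast
      rw [inv_pow]
      field_simp
    · rw [smul_apply, hpow, inner_smul_right, Function.iterate_zero, id,
        ← inner_conj_symm, hl]
      simp only [map_add, map_mul, map_sub, map_one, map_pow, Complex.conj_ofReal,
        Complex.conj_conj]
      push_cast
      rw [inv_pow, inv_pow]
      field_simp
      ring
  rw [norm_mul, Complex.norm_real, Real.norm_of_nonneg hpos] at hcc
  rw [Nat.add_sub_cancel, ← hcc, ← hsum, norm_mul, norm_pow, Complex.norm_real,
    Real.norm_of_nonneg hr0.le]
  gcongr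

open Polynomial in
theorem norm_eval_ofReal_mul_add_le {p : ℂ[X]} {m : ℕ} (hm : 2 ≤ m) (hp : p.natDegree ≤ m)
    {r : ℝ} (hr : 1 ≤ r) {u : ℂ} (hu : ‖u‖ = 1) :
    ‖p.eval (r * u)‖ + (r ^ m - r ^ (m - 2)) * ‖p.coeff 0‖ ≤ r ^ m * maxOnUnitCircle p := by
  have h := norm_eval_ofReal_add_le (p := p.comp (C u * X)) hm (natDegree_comp_le.trans ?_)
    (M := maxOnUnitCircle p) (fun z hz => ?_) hr
  · simpa [mul_comm u, coeff_zero_eq_eval_zero] using h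
  · exact (Nat.mul_le_mul hp (natDegree_C_mul_le u X)).trans (by simp)
  · rw [eval_comp]
    exact norm_eval_le_maxOnUnitCircle p (by simp [hu, hz])

open Polynomial in
theorem norm_eval_ofReal_mul_add_le_of_natDegree_le_one {p : ℂ[X]} (hp : p.natDegree ≤ 1)
    {r : ℝ} (hr : 1 ≤ r) {u : ℂ} (hu : ‖u‖ = 1) :
    ‖p.eval (r * u)‖ + (r - 1) * ‖p.coeff 0‖ ≤ r * maxOnUnitCircle p := by
  have hev : ∀ z, p.eval z = p.coeff 0 + z * p.coeff 1 := fun z => by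
    rw [eval_eq_sum_range' (Nat.lt_succ_of_le hp)]; simp [Finset.sum_range_succ, mul_comm]
  obtain ⟨c, hc, h⟩ := exists_norm_eq_one_norm_add_mul (p.coeff 0) (p.coeff 1)
  have h1 := norm_eval_le_maxOnUnitCircle p hc
  rw [hev, h] at h1
  have h2 : ‖p.eval (r * u)‖ ≤ ‖p.coeff 0‖ + r * ‖p.coeff 1‖ := by
    rw [hev]
    refine (norm_add_le _ _).trans ?_
    rw [norm_mul, norm_mul, hu, Complex.norm_real, Real.norm_of_nonneg (by linarith), mul_one]
  nlinarith

/-! ### Logarithmic derivatives and the Erdős–Lax inequality. -/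

/-- Here `t` is the real inner product of `z` and `w`, so the denominator is `|z - w|²`. -/
theorem re_div_sub_eq {z w : ℂ} (h : z ≠ w) :
    ∃ t : ℝ, |t| ≤ ‖z‖ * ‖w‖ ∧ 0 < ‖z‖ ^ 2 + ‖w‖ ^ 2 - 2 * t ∧
      (z / (z - w)).re = (‖z‖ ^ 2 - t) / (‖z‖ ^ 2 + ‖w‖ ^ 2 - 2 * t) := by
  have hsq : ∀ x : ℂ, ‖x‖ ^ 2 = x.re ^ 2 + x.im ^ 2 := fun x => by
    rw [Complex.sq_norm, Complex.normSq_apply]; ring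
  have hd : ‖z‖ ^ 2 + ‖w‖ ^ 2 - 2 * (z.re * w.re + z.im * w.im) = ‖z - w‖ ^ 2 := by
    simp only [hsq, Complex.sub_re, Complex.sub_im]; ring
  refine ⟨z.re * w.re + z.im * w.im, abs_le_of_sq_le_sq ?_ (by positivity), ?_, ?_⟩
  · rw [mul_pow, hsq, hsq]
    nlinarith [sq_nonneg (z.re * w.im - z.im * w.re)]
  · rw [hd]
    have := norm_pos_iff.2 (sub_ne_zero.2 h)
    positivity
  · rw [hd, Complex.div_re, Complex.sq_norm (z - w), hsq, ← add_div]
    congr 1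
    simp only [Complex.sub_re, Complex.sub_im]; ring

theorem re_div_sub_le_half {z w : ℂ} (h : z ≠ w) (hzw : ‖z‖ ≤ ‖w‖) :
    (z / (z - w)).re ≤ 1 / 2 := by
  obtain ⟨t, -, h0, he⟩ := re_div_sub_eq h
  rw [he, div_le_div_iff₀ h0 two_pos]
  nlinarith [norm_nonneg z]

theorem div_add_norm_le_re_div_sub {z w : ℂ} (h : z ≠ w) (hzw : ‖w‖ ≤ ‖z‖) :
    ‖z‖ / (‖z‖ + ‖w‖) ≤ (z / (z - w)).re := by
  obtain ⟨t, ht, h0, he⟩ := re_div_sub_eq h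
  have hpos : 0 < ‖z‖ + ‖w‖ := by
    by_contra! hc
    refine h ?_
    rw [norm_eq_zero.1 (le_antisymm (by linarith [norm_nonneg w]) (norm_nonneg z)),
      norm_eq_zero.1 (le_antisymm (by linarith [norm_nonneg z]) (norm_nonneg w))]
  rw [he, div_le_div_iff₀ hpos h0]
  nlinarith [mul_nonneg (sub_nonneg.2 hzw) (by linarith [neg_le_of_abs_le ht] : 0 ≤ ‖z‖ * ‖w‖ + t)]

open Polynomial in
theorem re_mul_eval_derivative_div_eval {P : ℂ[X]} {z : ℂ} (hz : P.eval z ≠ 0) :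
    (z * P.derivative.eval z / P.eval z).re = (P.roots.map fun w => (z / (z - w)).re).sum := by
  rw [mul_div_assoc, (IsAlgClosed.splits P).eval_derivative_div_eval_of_ne_zero hz,
    ← Multiset.sum_map_mul_left, ← Complex.coe_reAddGroupHom, map_multiset_sum, Multiset.map_map]
  simp [div_eq_mul_inv]

-- Each zero contributes at most `1/2` to `Re(zT'/T)`, so `zT'/T` is at least as close to `0` as to
-- `n`.
open Polynomial in
theorem norm_mul_eval_derivative_le_norm_sub {T : ℂ[X]} {n : ℕ} (hT : T.natDegree ≤ n) {z : ℂ}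
    (hroot : ∀ w, T.eval w = 0 → ‖z‖ ≤ ‖w‖) :
    ‖z * T.derivative.eval z‖ ≤ ‖n * T.eval z - z * T.derivative.eval z‖ := by
  by_cases h0 : T.eval z = 0
  · simp [h0]
  have hre : (z * T.derivative.eval z / T.eval z).re ≤ n / 2 := by
    rw [re_mul_eval_derivative_div_eval h0]
    refine (Multiset.sum_le_card_nsmul _ (1 / 2 : ℝ) ?_).trans ?_
    · intro x hx
      obtain ⟨w, hw, rfl⟩ := Multiset.mem_map.1 hx
      have hw' : T.eval w = 0 := (mem_roots'.1 hw).2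
      exact re_div_sub_le_half (by rintro rfl; exact h0 hw') (hroot w hw')
    · have : (T.roots.card : ℝ) ≤ n := by exact_mod_cast (card_roots' T).trans hT
      rw [Multiset.card_map, nsmul_eq_mul]
      linarith
  set q := z * T.derivative.eval z / T.eval z with hq
  have hqe : z * T.derivative.eval z = q * T.eval z := by rw [hq]; field_simp
  have hle : ‖q‖ ≤ ‖(n : ℂ) - q‖ := by
    rw [← sq_le_sq₀ (norm_nonneg _) (norm_nonneg _), Complex.sq_norm, Complex.sq_norm,
      Complex.normSq_apply, Complex.normSq_apply]
    simp
    nlinarith [(Nat.cast_nonneg n : (0 : ℝ) ≤ n)]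
  rw [hqe, ← sub_mul, norm_mul, norm_mul]
  gcongr

open Polynomial in
theorem norm_eval_le_maxOnUnitCircle_of_norm_le_one (T : ℂ[X]) {z : ℂ} (hz : ‖z‖ ≤ 1) :
    ‖T.eval z‖ ≤ maxOnUnitCircle T := by
  refine Complex.norm_le_of_forall_mem_frontier_norm_le (U := Metric.ball 0 1)
    Metric.isBounded_ball T.differentiable.diffContOnCl (fun w hw => ?_) ?_
  · rw [frontier_ball _ one_ne_zero] at hw
    exact norm_eval_le_maxOnUnitCircle T (by simpa using hw)
  · rw [closure_ball _ one_ne_zero]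
    simpa using hz

-- For `|c|` above the maximum of `|T|`, the maximum principle keeps the zeros of `T - c` out of the
-- closed disk, so the preceding comparison applies to it. The phase of `c` is then aligned with `nT
-- - zT'`.
open Polynomial in
theorem norm_mul_eval_derivative_add_norm_sub_le {T : ℂ[X]} {n : ℕ} (hn : n ≠ 0)
    (hT : T.natDegree ≤ n) {z : ℂ} (hz : ‖z‖ = 1) :
    ‖z * T.derivative.eval z‖ + ‖n * T.eval z - z * T.derivative.eval z‖ ≤
      n * maxOnUnitCircle T := by
  have hn0 : (0 : ℝ) < n := by positivity
  have hshift : ∀ c : ℂ, maxOnUnitCircle T < ‖c‖ → ‖z * T.derivative.eval z‖ ≤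
      ‖n * T.eval z - z * T.derivative.eval z - n * c‖ := by
    intro c hc
    have h := norm_mul_eval_derivative_le_norm_sub (T := T - C c) (n := n) (z := z)
      (natDegree_sub_C.trans_le hT) ?_
    · simp only [derivative_sub, derivative_C, sub_zero, eval_sub, eval_C] at h
      convert h using 2
      ring
    · intro w hw
      rw [eval_sub, eval_C, sub_eq_zero] at hw
      by_contra! hlt
      rw [hz] at hlt
      rw [← hw] at hc
      exact hc.not_ge (norm_eval_le_maxOnUnitCircle_of_norm_le_one T hlt.le)
  set A := z * T.derivative.eval z with hA
  set B := n * T.eval z - A with hB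
  obtain ⟨v, hv, hBv⟩ : ∃ v : ℂ, ‖v‖ = 1 ∧ B = ‖B‖ * v :=
    ⟨_, Complex.norm_exp_ofReal_mul_I B.arg, (Complex.norm_mul_exp_arg_mul_I B).symm⟩
  have hM0 := maxOnUnitCircle_nonneg T
  have hline : ∀ t : ℝ, maxOnUnitCircle T < t → ‖A‖ ≤ |‖B‖ - n * t| := by
    intro t ht
    refine (hshift (t * v) ?_).trans_eq ?_
    · rwa [norm_mul, hv, Complex.norm_real, Real.norm_of_nonneg (by linarith), mul_one]
    · conv_lhs => rw [hBv]
      rw [show (‖B‖ : ℂ) * v - n * (t * v) = ((‖B‖ - n * t : ℝ) : ℂ) * v by push_cast; ring,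
        norm_mul, hv, Complex.norm_real, mul_one, Real.norm_eq_abs]
  by_contra! hcon
  rcases le_or_gt ‖B‖ (n * maxOnUnitCircle T) with hle | hgt
  · have hnt : n * (((‖A‖ + ‖B‖) / n + maxOnUnitCircle T) / 2) =
        (‖A‖ + ‖B‖ + n * maxOnUnitCircle T) / 2 := by field_simp
    have h := hline (((‖A‖ + ‖B‖) / n + maxOnUnitCircle T) / 2) (by
      have : maxOnUnitCircle T < (‖A‖ + ‖B‖) / n := by rw [lt_div_iff₀ hn0]; linarith
      linarith)
    rw [hnt, abs_of_nonpos (by linarith)] at h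
    linarith
  · have h := hline (‖B‖ / n) (by rw [lt_div_iff₀ hn0]; linarith)
    rw [mul_div_cancel₀ _ hn0.ne', sub_self, abs_zero] at h
    have hA0 : A = 0 := norm_le_zero_iff.1 h
    rw [hB, hA0, sub_zero, norm_mul, Complex.norm_natCast] at hgt
    exact hgt.not_ge (by gcongr; exact norm_eval_le_maxOnUnitCircle T hz)

open Polynomial in
/-- The Erdős–Lax inequality. -/
theorem maxOnUnitCircle_derivative_le_of_roots {T : ℂ[X]} {n : ℕ} (hn : n ≠ 0)
    (hT : T.natDegree ≤ n) (hroot : ∀ w, T.eval w = 0 → 1 ≤ ‖w‖) :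
    maxOnUnitCircle T.derivative ≤ n / 2 * maxOnUnitCircle T := by
  obtain ⟨z, hz, h⟩ := exists_norm_eval_eq_maxOnUnitCircle T.derivative
  have h1 := norm_mul_eval_derivative_add_norm_sub_le hn hT hz
  have h2 := norm_mul_eval_derivative_le_norm_sub hT (z := z) (fun w hw => hz ▸ hroot w hw)
  rw [norm_mul, hz, one_mul, h] at h1 h2
  linarith

/-! ### Refined Ankeny–Rivlin inequality and the reciprocal polynomial. -/

/-- The derivative of `govilPhi` with respect to `k`. -/
noncomputable def govilPhiDeriv (n : ℕ) (r : ℝ) : ℝ :=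
  if n = 2 then r - 1 else r ^ (n - 1) - r ^ (n - 3)

theorem hasDerivAt_govilPhi {n : ℕ} (hn : 2 ≤ n) (r : ℝ) :
    HasDerivAt (govilPhi n) (govilPhiDeriv n r) r := by
  unfold govilPhi govilPhiDeriv
  split_ifs with h
  · refine ((((hasDerivAt_id r).sub_const 1).pow 2).div_const 2).congr_deriv ?_
    simp
  · obtain ⟨m, rfl⟩ : ∃ m, n = m + 3 := ⟨n - 3, by omega⟩
    refine ((((hasDerivAt_pow (m + 3) r).sub_const 1).div_const _).sub
      (((hasDerivAt_pow (m + 3 - 2) r).sub_const 1).div_const _)).congr_deriv ?_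
    have h1 : (m : ℝ) + 3 ≠ 0 := by positivity
    have h2 : (m : ℝ) + 3 - 2 ≠ 0 := by
      have : (0 : ℝ) ≤ m := by positivity
      linarith
    have h3 : ((m + 3 - 2 : ℕ) : ℝ) = (m : ℝ) + 3 - 2 := by
      rw [show m + 3 - 2 = m + 1 by omega]; push_cast; ring
    rw [h3, show m + 3 - 2 - 1 = m + 3 - 3 by omega]
    push_cast
    field_simp

theorem govilPhi_one {n : ℕ} : govilPhi n 1 = 0 := by
  simp [govilPhi]

theorem govilPhiDeriv_nonneg {n : ℕ} {r : ℝ} (hr : 1 ≤ r) : 0 ≤ govilPhiDeriv n r := by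
  unfold govilPhiDeriv
  split_ifs
  · linarith
  · exact sub_nonneg.2 (pow_le_pow_right₀ hr (by omega))

theorem govilPhi_nonneg {n : ℕ} (hn : 2 ≤ n) {k : ℝ} (hk : 1 ≤ k) : 0 ≤ govilPhi n k := by
  have h := monotoneOn_of_deriv_nonneg (convex_Ici (1 : ℝ)) (f := govilPhi n)
    (fun x _ => (hasDerivAt_govilPhi hn x).continuousAt.continuousWithinAt)
    (fun x _ => (hasDerivAt_govilPhi hn x).differentiableAt.differentiableWithinAt)
    (fun x hx => by
      rw [(hasDerivAt_govilPhi hn x).deriv]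
      rw [interior_Ici] at hx
      exact govilPhiDeriv_nonneg (le_of_lt hx))
  simpa [govilPhi_one] using h Set.self_mem_Ici hk hk

-- The case `n = 2` is separate because `q` is then affine and the coefficient is `r - 1`; this is
-- the source of the case split in `φ` and `ψ`.
open Polynomial in
theorem norm_eval_ofReal_mul_add_govilPhiDeriv_le {q : ℂ[X]} {n : ℕ} (hn : 2 ≤ n)
    (hq : q.natDegree ≤ n - 1) {r : ℝ} (hr : 1 ≤ r) {u : ℂ} (hu : ‖u‖ = 1) :
    ‖q.eval (r * u)‖ + govilPhiDeriv n r * ‖q.coeff 0‖ ≤ r ^ (n - 1) * maxOnUnitCircle q := by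
  unfold govilPhiDeriv
  split_ifs with h
  · subst h
    simpa using norm_eval_ofReal_mul_add_le_of_natDegree_le_one hq hr hu
  · exact norm_eval_ofReal_mul_add_le (by omega) hq hr hu

open Polynomial in
/-- A refinement of the Ankeny–Rivlin inequality. -/
theorem norm_eval_ofReal_mul_le_of_roots {T : ℂ[X]} {n : ℕ} (hn : 2 ≤ n)
    (hT : T.natDegree ≤ n) (hroot : ∀ w, T.eval w = 0 → 1 ≤ ‖w‖) {R : ℝ} (hR : 1 ≤ R) {u : ℂ}
    (hu : ‖u‖ = 1) :
    ‖T.eval (R * u)‖ ≤ (R ^ n + 1) / 2 * maxOnUnitCircle T - ‖T.coeff 1‖ * govilPhi n R := by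
  have hd : ∀ x : ℝ, HasDerivAt (fun x : ℝ => T.eval (x * u)) (T.derivative.eval (x * u) * u) x :=
    fun x => by
      have h1 : HasDerivAt (fun z : ℂ => z * u) u (x : ℂ) := by
        simpa using (hasDerivAt_id (x : ℂ)).mul_const u
      exact HasDerivAt.comp_ofReal (e := fun z => T.eval (z * u)) ((T.hasDerivAt _).comp _ h1)
  have hB : ∀ x : ℝ, HasDerivAt
      (fun x => (x ^ n + 1) / 2 * maxOnUnitCircle T - ‖T.coeff 1‖ * govilPhi n x)
      (n * x ^ (n - 1) / 2 * maxOnUnitCircle T - ‖T.coeff 1‖ * govilPhiDeriv n x) x := fun x =>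
    ((((hasDerivAt_pow n x).add_const 1).div_const 2).mul_const _).sub
      ((hasDerivAt_govilPhi hn x).const_mul _)
  -- Growth of `T'` and Erdős–Lax bound the speed of `x ↦ T(xu)` by the derivative of the right-hand
  -- side; at `x = 1` that side is the maximum of `|T|`, since `φ(1) = 0`.
  refine image_norm_le_of_norm_deriv_right_le_deriv_boundary (a := 1) (b := R)
    (fun x _ => (hd x).continuousAt.continuousWithinAt) (fun x _ => (hd x).hasDerivWithinAt)
    ?_ hB (fun x hx => ?_) (Set.right_mem_Icc.2 hR)
  · rw [govilPhi_one, Complex.ofReal_one, one_mul]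
    simpa using norm_eval_le_maxOnUnitCircle T hu
  · have h1 := norm_eval_ofReal_mul_add_govilPhiDeriv_le hn
      ((natDegree_derivative_le T).trans (Nat.sub_le_sub_right hT 1)) hx.1 hu
    have h2 := maxOnUnitCircle_derivative_le_of_roots (by omega) hT hroot
    have h3 : (0 : ℝ) ≤ x ^ (n - 1) := pow_nonneg (by linarith [hx.1]) _
    rw [coeff_derivative] at h1
    norm_num at h1
    rw [norm_mul, hu, mul_one]
    nlinarith [mul_le_mul_of_nonneg_left h2 h3]

open Polynomial in
theorem exists_maxOnUnitCircle_add_le {P : ℂ[X]} {n : ℕ} (hn : 2 ≤ n) (hP : P.natDegree = n)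
    {k : ℝ} (hk : 1 ≤ k) (hroot : ∀ z, P.eval z = 0 → ‖z‖ ≤ k) :
    ∃ v : ℂ, ‖v‖ = 1 ∧ maxOnUnitCircle P + ‖P.coeff (n - 1)‖ / k * govilPhi n k ≤
      (k ^ n + 1) / (2 * k ^ n) * ‖P.eval (k * v)‖ := by
  have hk0 : 0 < k := by linarith
  have hkc : (k : ℂ) ≠ 0 := by exact_mod_cast hk0.ne'
  have hP0 : P ≠ 0 := by rintro rfl; simp at hP; omega
  set T : ℂ[X] := P.reverse.comp (C (k : ℂ)⁻¹ * X) with hTdef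
  have hTe : ∀ z : ℂ, z ≠ 0 → T.eval z = (z / k) ^ n * P.eval (k / z) := by
    intro z hz
    have : Invertible (k / z : ℂ) := invertibleOfNonzero (div_ne_zero hkc hz)
    have h := eval₂_reverse_mul_pow (RingHom.id ℂ) (k / z) P
    rw [invOf_eq_inv, inv_div, hP] at h
    rw [hTdef, eval_comp, eval_mul, eval_C, eval_X, inv_mul_eq_div]
    simp only [eval₂_id] at h
    rw [← h, mul_left_comm, ← mul_pow, div_mul_div_cancel₀ hkc, div_self hz, one_pow, mul_one]
  have hTd : T.natDegree ≤ n :=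
    natDegree_comp_le.trans ((Nat.mul_le_mul (hP ▸ reverse_natDegree_le P)
      (natDegree_C_mul_le _ X)).trans (by simp))
  have hT1 : ‖T.coeff 1‖ = ‖P.coeff (n - 1)‖ / k := by
    rw [hTdef, comp_C_mul_X_coeff, coeff_one_reverse, nextCoeff_of_natDegree_pos (by omega), hP,
      pow_one, norm_mul, norm_inv, Complex.norm_real, Real.norm_of_nonneg hk0.le, div_eq_mul_inv]
  have hTroot : ∀ w, T.eval w = 0 → 1 ≤ ‖w‖ := by
    intro w hw
    by_cases hw0 : w = 0
    · subst hw0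
      simp [hTdef, ← coeff_zero_eq_eval_zero, hP0] at hw
    · rw [hTe w hw0, mul_eq_zero, or_iff_right (pow_ne_zero _ (div_ne_zero hw0 hkc))] at hw
      have h := hroot _ hw
      rw [norm_div, Complex.norm_real, Real.norm_of_nonneg hk0.le,
        div_le_iff₀ (norm_pos_iff.2 hw0)] at h
      nlinarith
  obtain ⟨v, hv, hvT⟩ := exists_norm_eval_eq_maxOnUnitCircle T
  obtain ⟨z, hz, hzP⟩ := exists_norm_eval_eq_maxOnUnitCircle P
  have hv0 : v ≠ 0 := by rintro rfl; simp at hv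
  have hz0 : z ≠ 0 := by rintro rfl; simp at hz
  -- `T` at its maximum point `v` is `P(k/v)` up to a factor of modulus `k^(-n)`, and `T` at `k/z`
  -- has modulus `|P(z)|`, the maximum for `P`.
  refine ⟨v⁻¹, by simp [hv], ?_⟩
  have h := norm_eval_ofReal_mul_le_of_roots hn hTd hTroot hk (u := z⁻¹) (by simp [hz])
  rw [← div_eq_mul_inv, hTe _ (div_ne_zero hkc hz0), div_div_cancel₀ hkc, ← hvT, hTe v hv0,
    norm_mul, norm_mul, hzP, hT1, norm_pow, norm_pow, norm_div, norm_div, norm_div, hz, hv,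
    Complex.norm_real, Real.norm_of_nonneg hk0.le, div_one, div_self hk0.ne', one_pow, one_mul,
    div_pow, one_pow] at h
  rw [← div_eq_mul_inv]
  have : (k ^ n + 1) / 2 * (1 / k ^ n * ‖P.eval (k / v)‖) =
    (k ^ n + 1) / (2 * k ^ n) * ‖P.eval (k / v)‖ := by field_simp
  linarith

/-! ### Dubinin's inequality. -/

/-- After clearing denominators this is `(1 - x)(1 - y)(1 - xy) ≥ 0`. It merges two zeros into one
carrying the product of their moduli. -/
theorem one_div_add_one_div_ge {x y : ℝ} (hx : 0 ≤ x) (hx1 : x ≤ 1) (hy : 0 ≤ y) (hy1 : y ≤ 1) :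
    1 / 2 + 1 / (1 + x * y) ≤ 1 / (1 + x) + 1 / (1 + y) := by
  rw [div_add_div _ _ (by positivity) (by positivity),
    div_add_div _ _ (by positivity) (by positivity), div_le_div_iff₀ (by positivity) (by positivity)]
  nlinarith [mul_nonneg (mul_nonneg (sub_nonneg.2 hx1) (sub_nonneg.2 hy1))
    (sub_nonneg.2 (mul_le_one₀ hx1 hy hy1))]

theorem norm_multiset_prod_le_pow_card {k : ℝ} (s : Multiset ℂ) (hs : ∀ w ∈ s, ‖w‖ ≤ k) :
    ‖s.prod‖ ≤ k ^ s.card := by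
  induction s using Multiset.induction_on with
  | empty => simp
  | cons a s ih =>
    have ha := hs a (Multiset.mem_cons_self a s)
    rw [Multiset.prod_cons, norm_mul, Multiset.card_cons, pow_succ']
    gcongr
    · exact (norm_nonneg a).trans ha
    · exact ih fun w hw => hs w (Multiset.mem_cons_of_mem hw)

/-- Merging zeros one at a time leaves a bound in the product of the zeros alone, hence in
`|a_0/a_n|`. -/
theorem half_card_add_le_sum_div_add_norm {k : ℝ} (hk : 0 < k) (s : Multiset ℂ)
    (hs : ∀ w ∈ s, ‖w‖ ≤ k) :
    ((s.card : ℝ) - 1) / 2 + k ^ s.card / (k ^ s.card + ‖s.prod‖) ≤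
      (s.map fun w => k / (k + ‖w‖)).sum := by
  induction s using Multiset.induction_on with
  | empty => norm_num
  | cons a s ih =>
    have ha := hs a (Multiset.mem_cons_self a s)
    have hs' : ∀ w ∈ s, ‖w‖ ≤ k := fun w hw => hs w (Multiset.mem_cons_of_mem hw)
    have hK : 0 < k ^ s.card := by positivity
    have h1 : ∀ {K x : ℝ}, 0 < K → 0 ≤ x → K / (K + x) = 1 / (1 + x / K) := fun hK hx => by
      field_simp
    have h := one_div_add_one_div_ge (x := ‖a‖ / k) (y := ‖s.prod‖ / k ^ s.card) (by positivity)
      (div_le_one_of_le₀ ha hk.le) (by positivity)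
      (div_le_one_of_le₀ (norm_multiset_prod_le_pow_card s hs') hK.le)
    rw [div_mul_div_comm, ← h1 (by positivity) (by positivity), ← h1 hk (norm_nonneg a),
      ← h1 hK (norm_nonneg _), ← pow_succ', ← norm_mul] at h
    rw [Multiset.map_cons, Multiset.sum_cons, Multiset.card_cons, Multiset.prod_cons]
    push_cast
    linarith [ih hs']

open Polynomial in
theorem norm_coeff_zero_eq (P : ℂ[X]) :
    ‖P.coeff 0‖ = ‖P.coeff P.natDegree‖ * ‖P.roots.prod‖ := by
  rw [(IsAlgClosed.splits P).coeff_zero_eq_leadingCoeff_mul_prod_roots]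
  simp

open Polynomial in
theorem norm_coeff_zero_le {P : ℂ[X]} {k : ℝ} (hroot : ∀ z, P.eval z = 0 → ‖z‖ ≤ k) :
    ‖P.coeff 0‖ ≤ k ^ P.natDegree * ‖P.coeff P.natDegree‖ := by
  have h := norm_multiset_prod_le_pow_card P.roots
    fun w hw => hroot w (mem_roots'.1 hw).2
  rw [← (IsAlgClosed.splits P).natDegree_eq_card_roots] at h
  rw [norm_coeff_zero_eq, mul_comm]
  gcongr

open Polynomial in
theorem coeffFactor_half_eq {P : ℂ[X]} (hP : P ≠ 0) {k : ℝ} (hk : 0 < k) :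
    coeffFactor P.natDegree k P / 2 = ((P.natDegree : ℝ) - 1) / 2 +
      k ^ P.natDegree / (k ^ P.natDegree + ‖P.roots.prod‖) := by
  have hc : 0 < ‖P.coeff P.natDegree‖ := norm_pos_iff.2 (by simpa using hP)
  unfold coeffFactor
  rw [norm_coeff_zero_eq]
  have hK : 0 < k ^ P.natDegree := by positivity
  have : 0 < k ^ P.natDegree + ‖P.roots.prod‖ := by positivity
  rw [mul_comm (k ^ _), ← mul_sub, ← mul_add, mul_div_mul_left _ _ hc.ne']
  field_simp
  ring

open Polynomial in
/-- Dubinin's inequality, pointwise on the circle of radius `k`. -/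
theorem coeffFactor_half_mul_norm_eval_le {P : ℂ[X]} {k : ℝ} (hk : 0 < k)
    (hroot : ∀ z, P.eval z = 0 → ‖z‖ ≤ k) {z : ℂ} (hz : ‖z‖ = k) :
    coeffFactor P.natDegree k P / 2 * ‖P.eval z‖ ≤ k * ‖P.derivative.eval z‖ := by
  by_cases h0 : P.eval z = 0
  · rw [h0, norm_zero, mul_zero]; positivity
  have hP : P ≠ 0 := by rintro rfl; simp at h0
  have hmem : ∀ w ∈ P.roots, P.eval w = 0 := fun w hw => (mem_roots'.1 hw).2
  have hre : coeffFactor P.natDegree k P / 2 ≤ (z * P.derivative.eval z / P.eval z).re := by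
    rw [coeffFactor_half_eq hP hk, re_mul_eval_derivative_div_eval h0]
    have h := half_card_add_le_sum_div_add_norm hk P.roots fun w hw => hroot w (hmem w hw)
    rw [← (IsAlgClosed.splits P).natDegree_eq_card_roots] at h
    refine h.trans (Multiset.sum_map_le_sum_map _ _ fun w hw => ?_)
    rw [← hz]
    exact div_add_norm_le_re_div_sub (by rintro rfl; exact h0 (hmem _ hw))
      (hz ▸ hroot w (hmem w hw))
  have hnorm := hre.trans (Complex.re_le_norm _)
  rw [norm_div, norm_mul, hz, le_div_iff₀ (norm_pos_iff.2 h0)] at hnorm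
  exact hnorm

/-! ### Assembly and the extremal polynomial. -/

theorem govilPsi_nonneg {n : ℕ} {k : ℝ} (hk : 1 ≤ k) : 0 ≤ govilPsi n k := by
  unfold govilPsi
  split_ifs
  · exact sub_nonneg.2 (div_le_one_of_le₀ hk (by linarith))
  · exact sub_nonneg.2 (div_le_one_of_le₀ (one_le_pow₀ hk) (by positivity))

theorem mul_govilPhiDeriv {n : ℕ} (hn : 2 ≤ n) {k : ℝ} (hk : k ≠ 0) :
    k * govilPhiDeriv n k = k ^ n * govilPsi n k := by
  unfold govilPhiDeriv govilPsi
  split_ifs with h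
  · subst h; field_simp
  · obtain ⟨m, rfl⟩ : ∃ m, n = m + 3 := ⟨n - 3, by omega⟩
    simp only [Nat.add_sub_cancel, show m + 3 - 1 = m + 2 by omega]
    field_simp
    ring

theorem natCast_le_coeffFactor {P : Polynomial ℂ} {k : ℝ} (hk : 0 < k)
    (hroot : ∀ z, P.eval z = 0 → ‖z‖ ≤ k) : (P.natDegree : ℝ) ≤ coeffFactor P.natDegree k P := by
  have := norm_coeff_zero_le hroot
  exact le_add_of_nonneg_right (div_nonneg (by linarith) (by positivity))

open Polynomial in
theorem derivLowerBound_le_maxOnUnitCircle_derivative {P : ℂ[X]} (hn : 2 ≤ P.natDegree) {k : ℝ}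
    (hk : 1 ≤ k) (hroot : ∀ z, P.eval z = 0 → ‖z‖ ≤ k) :
    derivLowerBound P.natDegree k P ≤ maxOnUnitCircle (derivative P) := by
  have hk0 : 0 < k := by linarith
  obtain ⟨v, hv, h1⟩ := exists_maxOnUnitCircle_add_le hn rfl hk hroot
  have h2 := coeffFactor_half_mul_norm_eval_le hk0 hroot (z := k * v)
    (by rw [norm_mul, hv, Complex.norm_real, Real.norm_of_nonneg hk0.le, mul_one])
  have h3 := norm_eval_ofReal_mul_add_govilPhiDeriv_le hn (natDegree_derivative_le P) hk hv
  have hF : 0 ≤ coeffFactor P.natDegree k P :=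
    (Nat.cast_nonneg _).trans (natCast_le_coeffFactor hk0 hroot)
  rw [coeff_derivative] at h3
  norm_num at h3
  have h4 := mul_govilPhiDeriv hn hk0.ne'
  have h5 : k * k ^ (P.natDegree - 1) = k ^ P.natDegree := by
    rw [← pow_succ', Nat.sub_add_cancel (by omega)]
  -- Dubinin at `kv` followed by growth of `P'`; `h7` is estimate (1) scaled by `F/(1 + k^n)`, which
  -- makes the two chain at `h10`.
  have h6 := h2.trans (mul_le_mul_of_nonneg_left (le_sub_iff_add_le.2 h3) hk0.le)
  rw [mul_sub, ← mul_assoc, h5, ← mul_assoc, h4] at h6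
  have hK : 0 < k ^ P.natDegree := by positivity
  have h7 := mul_le_mul_of_nonneg_left h1
    (show 0 ≤ coeffFactor P.natDegree k P / (1 + k ^ P.natDegree) by positivity)
  have h8 : coeffFactor P.natDegree k P / (1 + k ^ P.natDegree) *
      ((k ^ P.natDegree + 1) / (2 * k ^ P.natDegree) * ‖P.eval (k * v)‖) =
      (coeffFactor P.natDegree k P / 2 * ‖P.eval (k * v)‖) / k ^ P.natDegree := by
    field_simp
    ring
  have h9 := div_le_div_of_nonneg_right h6 hK.le
  rw [← h8] at h9
  have h10 := h7.trans h9
  rw [show (k ^ P.natDegree * maxOnUnitCircle (derivative P) -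
    k ^ P.natDegree * govilPsi P.natDegree k * ‖P.coeff 1‖) / k ^ P.natDegree =
    maxOnUnitCircle (derivative P) - govilPsi P.natDegree k * ‖P.coeff 1‖ by field_simp] at h10
  have h11 : derivLowerBound P.natDegree k P =
      coeffFactor P.natDegree k P / (1 + k ^ P.natDegree) *
        (maxOnUnitCircle P + ‖P.coeff (P.natDegree - 1)‖ / k * govilPhi P.natDegree k) +
      govilPsi P.natDegree k * ‖P.coeff 1‖ := by
    unfold derivLowerBound
    field_simp
  linarith

open Polynomial in
theorem maxOnUnitCircle_X_pow_add_C {n : ℕ} {c : ℝ} (hc : 0 ≤ c) :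
    maxOnUnitCircle (X ^ n + C (c : ℂ)) = 1 + c := by
  apply le_antisymm
  · obtain ⟨z, hz, h⟩ := exists_norm_eval_eq_maxOnUnitCircle (X ^ n + C (c : ℂ))
    rw [← h]
    simp only [eval_add, eval_pow, eval_X, eval_C]
    refine (norm_add_le _ _).trans ?_
    rw [norm_pow, hz, one_pow, Complex.norm_real, Real.norm_of_nonneg hc]
  · refine le_trans ?_ (norm_eval_le_maxOnUnitCircle _ (z := 1) (by simp))
    simp only [eval_add, eval_pow, eval_X, eval_C, one_pow]
    rw [show (1 : ℂ) + c = ((1 + c : ℝ) : ℂ) by push_cast; ring, Complex.norm_real]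
    exact le_abs_self _

open Polynomial in
theorem maxOnUnitCircle_derivative_X_pow_add_C {n : ℕ} (c : ℂ) :
    maxOnUnitCircle (derivative (X ^ n + C c)) = n := by
  obtain ⟨z, hz, h⟩ := exists_norm_eval_eq_maxOnUnitCircle (derivative (X ^ n + C c))
  rw [← h, derivative_add, derivative_C, add_zero, derivative_X_pow]
  simp [hz]

theorem theorem1 (n : ℕ) (hn : 2 ≤ n) (k : ℝ) (hk : 1 ≤ k) :
    (∀ P : Polynomial ℂ, P.natDegree = n → (∀ z : ℂ, P.eval z = 0 → ‖z‖ ≤ k) →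
      derivLowerBound n k P ≤ maxOnUnitCircle (Polynomial.derivative P) ∧
      (n : ℝ) / (1 + k ^ n) * maxOnUnitCircle P ≤ derivLowerBound n k P ∧
      (k = 1 → derivLowerBound n k P =
        1 / 2 * ((n : ℝ) + (‖P.coeff n‖ - ‖P.coeff 0‖) / (‖P.coeff n‖ + ‖P.coeff 0‖)) *
          maxOnUnitCircle P)) ∧
    maxOnUnitCircle (Polynomial.derivative
        (Polynomial.X ^ n + Polynomial.C ((k : ℂ) ^ n))) =
      derivLowerBound n k (Polynomial.X ^ n + Polynomial.C ((k : ℂ) ^ n)) := by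
  have hk0 : 0 < k := by linarith
  refine ⟨fun P hP hroot => ?_, ?_⟩
  · subst hP
    refine ⟨derivLowerBound_le_maxOnUnitCircle_derivative hn hk hroot, ?_, ?_⟩
    · have hF := natCast_le_coeffFactor hk0 hroot
      have hF0 : 0 ≤ coeffFactor P.natDegree k P := (Nat.cast_nonneg _).trans hF
      have hM := maxOnUnitCircle_nonneg P
      have hphi := govilPhi_nonneg hn hk
      have hpsi := govilPsi_nonneg (n := P.natDegree) hk
      unfold derivLowerBound
      rw [add_assoc, one_div_mul_eq_div]
      refine le_add_of_le_of_nonneg ?_ (by positivity)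
      gcongr
    · rintro rfl
      unfold derivLowerBound
      rw [govilPhi_one]
      simp only [coeffFactor, govilPsi, one_pow]
      norm_num
  -- For `z^n + k^n` the coefficients `a_1` and `a_{n-1}` vanish and `|a_0| = k^n |a_n|`, so `F = n`
  -- and both sides equal `n`.
  · rw [maxOnUnitCircle_derivative_X_pow_add_C]
    have hK : 0 < k ^ n := by positivity
    have hcn : (Polynomial.X ^ n + Polynomial.C ((k : ℂ) ^ n)).coeff n = 1 := by
      rw [Polynomial.coeff_add, Polynomial.coeff_X_pow, Polynomial.coeff_C, if_pos rfl,
        if_neg (by omega), add_zero]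
    have hc0 : (Polynomial.X ^ n + Polynomial.C ((k : ℂ) ^ n)).coeff 0 = (k : ℂ) ^ n := by
      rw [Polynomial.coeff_add, Polynomial.coeff_X_pow, Polynomial.coeff_C, if_neg (by omega),
        if_pos rfl, zero_add]
    have hc1 : (Polynomial.X ^ n + Polynomial.C ((k : ℂ) ^ n)).coeff 1 = 0 := by
      rw [Polynomial.coeff_add, Polynomial.coeff_X_pow, Polynomial.coeff_C, if_neg (by omega),
        if_neg one_ne_zero, add_zero]
    have hc2 : (Polynomial.X ^ n + Polynomial.C ((k : ℂ) ^ n)).coeff (n - 1) = 0 := by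
      rw [Polynomial.coeff_add, Polynomial.coeff_X_pow, Polynomial.coeff_C, if_neg (by omega),
        if_neg (by omega), add_zero]
    have hM : maxOnUnitCircle (Polynomial.X ^ n + Polynomial.C ((k : ℂ) ^ n)) = 1 + k ^ n := by
      rw [← Complex.ofReal_pow, maxOnUnitCircle_X_pow_add_C hK.le]
    unfold derivLowerBound coeffFactor
    rw [hcn, hc0, hc1, hc2, hM, norm_pow, Complex.norm_real, Real.norm_of_nonneg hk0.le]
    simp
    field_simp
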